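/- \textbf{Definitions.} Let $\mathcal M$ be a first-order structure; ``definable'' means definable in $\mathcal M$ with parameters. A \emph{definable Lie ring} is a Lie ring $\mathfrak g$ whose underlying set is a definable subset of some finite power of $\mathcal M$ and whose addition and bracket are definable. For an additive subgroup $N$ of $\mathfrak g$ and $g_1,\dots,g_i\in\mathfrak g$ put $$C_{\mathfrak g}(g_1,\dots,g_i/N)=\{x\in\mathfrak g : [g_j,x]\in N \text{ for } 1\le j\le i\},$$ which is $\mathfrak g$ when $i=0$. A definable Lie ring $\mathfrak g$ is \emph{hereditarily $\widetilde{\mathfrak M}_c$} if for every definable additive subgroup $N$ of $\mathfrak g$ there are natural numbers $n,d$ such that there do not exist $g_1,\dots,g_n\in\mathfrak g$ with $$|C_{\mathfrak g}(g_1,\dots,g_i/N):C_{\mathfrak g}(g_1,\dots,g_{i+1}/N)|\ge d\quad\text{for every } 0\le i\le n-1,$$ where infinite indices count as $\ge d$. The \emph{Fitting ideal} $F(\mathfrak g)$ is the sum of all ideals of $\mathfrak g$ that are nilpotent as Lie rings. \textbf{Theorem.} Let $\mathfrak g$ be a definable hereditarily $\widetilde{\mathfrak M}_c$-Lie ring.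 Then $F(\mathfrak g)$ is a nilpotent Lie ring. -/

import Mathlib

open FirstOrder

universe u v w

/-- `G`, a subset of a finite Cartesian power of the `L`-structure `M` carrying a Lie ring
structure, is a definable Lie ring: its carrier and the graphs of its addition and of its bracket
are definable in `M` with parameters. -/
structure IsDefinableLieRing (L : FirstOrder.Language.{u, v}) {M : Type w} [L.Structure M] {k : ℕ}
    (G : Set (Fin k → M)) [LieRing G] : Prop where
  carrier : (Set.univ : Set M).Definable L G
  add : (Set.univ : Set M).Definable L
    {p : Fin 3 × Fin k → M | ∃ x y : G, (fun i => p (0, i)) = (x : Fin k → M) ∧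
      (fun i => p (1, i)) = (y : Fin k → M) ∧ (fun i => p (2, i)) = ((x + y : G) : Fin k → M)}
  bracket : (Set.univ : Set M).Definable L
    {p : Fin 3 × Fin k → M | ∃ x y : G, (fun i => p (0, i)) = (x : Fin k → M) ∧
      (fun i => p (1, i)) = (y : Fin k → M) ∧ (fun i => p (2, i)) = ((⁅x, y⁆ : G) : Fin k → M)}

/-- An additive subgroup of `G` is definable if, as a subset of `M ^ k`, it is definable in `M`
with parameters. -/
def IsDefinableSubgroup (L : FirstOrder.Language.{u, v}) {M : Type w} [L.Structure M] {k : ℕ}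
    {G : Set (Fin k → M)} [LieRing G] (N : AddSubgroup G) : Prop :=
  (Set.univ : Set M).Definable L ((fun x : G => (x : Fin k → M)) '' (N : Set G))

/-- The centraliser `C_𝔤(S / N)` of a set `S` modulo an additive subgroup `N`. -/
def centraliserMod {𝔤 : Type*} [LieRing 𝔤] (S : Set 𝔤) (N : AddSubgroup 𝔤) : AddSubgroup 𝔤 where
  carrier := {y | ∀ s ∈ S, ⁅s, y⁆ ∈ N}
  zero_mem' := fun s _ => by simp
  add_mem' := fun {a b} ha hb s hs => by
    rw [lie_add]
    exact N.add_mem (ha s hs) (hb s hs)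
  neg_mem' := fun {a} ha s hs => by
    rw [lie_neg]
    exact N.neg_mem (ha s hs)

/-- The index `|H : K|` of `H ⊓ K` in `H` is at least `d` (it may be infinite; `relIndex` is `0`
exactly when the index is infinite). -/
def IndexAtLeast {𝔤 : Type*} [AddGroup 𝔤] (H K : AddSubgroup 𝔤) (d : ℕ) : Prop :=
  K.relIndex H = 0 ∨ d ≤ K.relIndex H

/-- The definable Lie ring `G` is hereditarily `M̃_c`: for every definable subgroup `N` there are
`n` and `d` such that no `g₀, …, g_{n-1}` in `G` satisfy
`|C(g₀, …, g_{i-1} / N) : C(g₀, …, g_i / N)| ≥ d` for all `i < n`. -/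
def IsHereditarilyMc (L : FirstOrder.Language.{u, v}) {M : Type w} [L.Structure M] {k : ℕ}
    (G : Set (Fin k → M)) [LieRing G] : Prop :=
  ∀ N : AddSubgroup G, IsDefinableSubgroup L N →
    ∃ n d : ℕ, ¬ ∃ g : Fin n → G, ∀ i : Fin n,
      IndexAtLeast (centraliserMod (g '' {j | j < i}) N) (centraliserMod (g '' {j | j ≤ i}) N) d

/-- The Fitting ideal: the sum of all ideals that are nilpotent as Lie rings. -/
def fittingIdeal (𝔤 : Type*) [LieRing 𝔤] : LieIdeal ℤ 𝔤 :=
  sSup {I : LieIdeal ℤ 𝔤 | LieRing.IsNilpotent I}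

/-! An ideal is nilpotent exactly when it acts nilpotently on the whole ring, and a sum of two such
ideals is again one. Hence every element of the Fitting ideal lies in an ideal acting nilpotently
(`LocallyActsNilpotently`), and the chain condition has to make this uniform.

Nothing ensures that centralisers of arbitrary ideals are definable, so they are replaced by almost
centralisers, which are definable and have bounded indices (`IsChainFamily.almostCentralizer_mem`).
Bounded indices force brackets to be finite on a piece of finite index, by Neumann's covering lemma
(`relIndex_almostCentralizer_ne_zero`) and a BFC-type argument (`relIndex_lie_ne_zero`). The finite
sections that appear are harmless: a locally nilpotent action on a finite section is nilpotent.

This yields an extension criterion (`IsChainFamily.actsNilpotently_of_iterLie_le`): if `H` is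
locally nilpotent in this sense and nilpotent modulo a nilpotently acting `J`, then `H` acts
nilpotently. Finally, `IsChainFamily.actsNilpotently` is an induction along chains of centralisers.
An ideal `H` is reduced to a derived ideal `⁅H', H'⁆` with `H'` of finite index in `H`; this is
either contained in a finite ideal or almost centralised by an element `h` whose centraliser has
infinite index in `H`, so that the chain gets longer. -/

namespace LieRing

/-! ### Iterated brackets of ideals and nilpotent actions. -/

section IteratedBracket

variable {𝔤 : Type*} [LieRing 𝔤]

/-- The iterated bracket `⁅H, ⁅H, … ⁅H, A⁆⁆⁆` with `n` factors `H`. -/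
def iterLie (H A : LieIdeal ℤ 𝔤) : ℕ → LieIdeal ℤ 𝔤
  | 0 => A
  | n + 1 => ⁅H, iterLie H A n⁆

@[simp] theorem iterLie_zero (H A : LieIdeal ℤ 𝔤) : iterLie H A 0 = A := rfl

theorem iterLie_succ (H A : LieIdeal ℤ 𝔤) (n : ℕ) : iterLie H A (n + 1) = ⁅H, iterLie H A n⁆ := rfl

theorem iterLie_add (H A : LieIdeal ℤ 𝔤) (m n : ℕ) :
    iterLie H A (m + n) = iterLie H (iterLie H A n) m := by
  induction m with
  | zero => simp
  | succ m ih => rw [Nat.succ_add, iterLie_succ, ih, iterLie_succ]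

theorem iterLie_succ' (H A : LieIdeal ℤ 𝔤) (n : ℕ) :
    iterLie H A (n + 1) = iterLie H ⁅H, A⁆ n := iterLie_add H A n 1

theorem iterLie_mono {H H' A A' : LieIdeal ℤ 𝔤} (hH : H ≤ H') (hA : A ≤ A') (n : ℕ) :
    iterLie H A n ≤ iterLie H' A' n := by
  induction n with
  | zero => exact hA
  | succ n ih => exact LieSubmodule.mono_lie hH ih

theorem iterLie_le (H A : LieIdeal ℤ 𝔤) (n : ℕ) : iterLie H A n ≤ A := by
  induction n with
  | zero => exact le_rfl
  | succ n ih => exact (LieSubmodule.lie_le_right _ _).trans ih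

theorem iterLie_antitone (H A : LieIdeal ℤ 𝔤) {m n : ℕ} (h : m ≤ n) :
    iterLie H A n ≤ iterLie H A m := by
  obtain ⟨k, rfl⟩ := Nat.exists_eq_add_of_le' h
  rw [iterLie_add]
  exact iterLie_le _ _ _

theorem iterLie_sup (H A B : LieIdeal ℤ 𝔤) (n : ℕ) :
    iterLie H (A ⊔ B) n = iterLie H A n ⊔ iterLie H B n := by
  induction n with
  | zero => rfl
  | succ n ih => rw [iterLie_succ, ih, LieSubmodule.lie_sup]; rfl

theorem iterLie_trans {H A B C : LieIdeal ℤ 𝔤} {m n : ℕ} (h₁ : iterLie H A n ≤ B)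
    (h₂ : iterLie H B m ≤ C) : iterLie H A (m + n) ≤ C := by
  rw [iterLie_add]
  exact (iterLie_mono le_rfl h₁ m).trans h₂

theorem exists_iterLie_not_le {H A B : LieIdeal ℤ 𝔤} {m : ℕ} (h : iterLie H A m ≤ B)
    (hA : ¬ A ≤ B) : ∃ j, ¬ iterLie H A j ≤ B ∧ ⁅H, iterLie H A j⁆ ≤ B := by
  induction m with
  | zero => exact absurd h hA
  | succ m ih =>
    by_cases h' : iterLie H A m ≤ B
    · exact ih h'
    · exact ⟨m, h', h⟩

/-- The centraliser `{y | ⁅K, y⁆ ⊆ N}` of an ideal `K` modulo an ideal `N`. -/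
def centralizerIdeal (K N : LieIdeal ℤ 𝔤) : LieIdeal ℤ 𝔤 where
  carrier := {y | ∀ k ∈ K, ⁅k, y⁆ ∈ N}
  zero_mem' := fun k _ => by simp
  add_mem' := fun ha hb k hk => by rw [lie_add]; exact add_mem (ha k hk) (hb k hk)
  smul_mem' := fun c y hy k hk => by rw [lie_smul]; exact N.smul_mem c (hy k hk)
  lie_mem := fun {x y} hy k hk => by
    rw [leibniz_lie]
    exact add_mem (hy _ (by rw [← lie_skew]; exact neg_mem (K.lie_mem hk))) (N.lie_mem (hy k hk))

theorem le_centralizerIdeal_iff {K N A : LieIdeal ℤ 𝔤} :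
    A ≤ centralizerIdeal K N ↔ ⁅K, A⁆ ≤ N := by
  rw [LieSubmodule.lie_le_iff]
  exact ⟨fun h x hx m hm => h hm x hx, fun h m hm x hx => h x hx m hm⟩

theorem le_centralizerIdeal (K N : LieIdeal ℤ 𝔤) : N ≤ centralizerIdeal K N :=
  le_centralizerIdeal_iff.2 (LieSubmodule.lie_le_right _ _)

theorem lie_lie_le (K H A : LieIdeal ℤ 𝔤) : ⁅K, ⁅H, A⁆⁆ ≤ ⁅⁅H, K⁆, A⁆ ⊔ ⁅H, ⁅K, A⁆⁆ := by
  rw [← le_centralizerIdeal_iff, LieSubmodule.lie_le_iff]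
  intro x hx a ha k hk
  rw [leibniz_lie k x a]
  refine add_mem (LieSubmodule.mem_sup_left ?_) (LieSubmodule.mem_sup_right ?_)
  · rw [LieSubmodule.lie_comm H K]
    exact LieSubmodule.lie_mem_lie (LieSubmodule.lie_mem_lie hk hx) ha
  · exact LieSubmodule.lie_mem_lie hx (LieSubmodule.lie_mem_lie hk ha)

/-- By `lie_lie_le`, a factor `H` taken out of the right-hand entry either lands on `K`, lowering
`s`, or moves outside, lowering `j` and raising `i`. Among `a + s` factors, either `s` reach `K` or
`a` end up outside. -/
theorem iterLie_lie_iterLie_le {H A B W : LieIdeal ℤ 𝔤} {a : ℕ} (hBA : B ≤ A) (s : ℕ) :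
    ∀ K : LieIdeal ℤ 𝔤, ⁅iterLie H K s, A⁆ ≤ W → iterLie H ⁅K, B⁆ a ≤ W →
      ∀ j i : ℕ, a + s ≤ i + j → iterLie H ⁅K, iterLie H B j⁆ i ≤ W := by
  induction s with
  | zero =>
    intro K h₁ _ j i _
    refine (iterLie_le _ _ _).trans ((LieSubmodule.mono_lie_right _ ?_).trans h₁)
    exact (iterLie_le _ _ _).trans hBA
  | succ s ih =>
    intro K h₁ h₂ j
    induction j with
    | zero => exact fun i hi => (iterLie_antitone _ _ (by omega)).trans h₂
    | succ j ihj =>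
      intro i hi
      refine (iterLie_mono le_rfl (lie_lie_le K H _) i).trans ?_
      rw [iterLie_sup, ← iterLie_succ']
      refine sup_le (ih ⁅H, K⁆ ?_ ?_ j i (by omega)) (ihj (i + 1) (by omega))
      · rwa [← iterLie_succ']
      · exact (iterLie_mono le_rfl (LieSubmodule.mono_lie_left _ (LieSubmodule.lie_le_right _ _))
          a).trans h₂

/-- If `H` acts nilpotently on the centraliser of `K` modulo `W`, if `K` acts nilpotently on `B`
and if deep brackets of `K` by `H` centralise `A`, then `H` acts nilpotently on `B`. -/
theorem exists_iterLie_le_of_centralizerIdeal {H K A W : LieIdeal ℤ 𝔤} {t s : ℕ}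
    (hC : iterLie H (centralizerIdeal K W) t ≤ W) (hs : ⁅iterLie H K s, A⁆ ≤ W) (m : ℕ) :
    ∀ B ≤ A, iterLie K B m ≤ W → ∃ r, iterLie H B r ≤ W := by
  induction m with
  | zero => exact fun B _ h => ⟨0, h⟩
  | succ m ih =>
    intro B hBA h
    rw [iterLie_succ'] at h
    obtain ⟨a, ha⟩ := ih ⁅K, B⁆ ((LieSubmodule.lie_le_right _ _).trans hBA) h
    -- With no outer factor, this says that `iterLie H B (a + s)` centralises `K` modulo `W`.
    have h' := iterLie_lie_iterLie_le hBA s K hs ha (a + s) 0 (by omega)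
    exact ⟨t + (a + s), iterLie_trans (le_centralizerIdeal_iff.2 h') hC⟩

/-- The ideal `I` acts nilpotently on the whole Lie ring. -/
def ActsNilpotently (I : LieIdeal ℤ 𝔤) : Prop := ∃ m, iterLie I ⊤ m ≤ ⊥

theorem ActsNilpotently.mono {I J : LieIdeal ℤ 𝔤} (hJ : ActsNilpotently J) (h : I ≤ J) :
    ActsNilpotently I :=
  hJ.imp fun m hm => (iterLie_mono h le_rfl m).trans hm

theorem iterLie_sup_le (I J A : LieIdeal ℤ 𝔤) (n : ℕ) :
    iterLie (I ⊔ J) A n ≤ iterLie I A n ⊔ ⁅J, A⁆ := by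
  induction n with
  | zero => exact le_sup_left
  | succ n ih =>
    rw [iterLie_succ, LieSubmodule.sup_lie]
    refine sup_le ((LieSubmodule.mono_lie_right _ ih).trans ?_)
      ((LieSubmodule.mono_lie_right _ (iterLie_le _ _ _)).trans le_sup_right)
    rw [LieSubmodule.lie_sup]
    exact sup_le_sup le_rfl (LieSubmodule.lie_le_right _ _)

/-- `J` acts trivially on each factor of its own series, so there `I ⊔ J` acts as `I`, and `n`
brackets descend one factor. -/
theorem ActsNilpotently.sup {I J : LieIdeal ℤ 𝔤} (hI : ActsNilpotently I)
    (hJ : ActsNilpotently J) : ActsNilpotently (I ⊔ J) := by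
  obtain ⟨n, hn⟩ := hI
  obtain ⟨k, hk⟩ := hJ
  have h : ∀ k, ∃ m, iterLie (I ⊔ J) ⊤ m ≤ iterLie J ⊤ k := by
    intro k
    induction k with
    | zero => exact ⟨0, le_rfl⟩
    | succ k ih =>
      obtain ⟨m, hm⟩ := ih
      refine ⟨n + m, iterLie_trans hm ((iterLie_sup_le I J _ n).trans (sup_le ?_ le_rfl))⟩
      exact ((iterLie_mono le_rfl le_top n).trans hn).trans bot_le
  exact (h k).imp fun m hm => hm.trans hk

end IteratedBracket
-- Indices, centralisers and almost centralisers.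
section Index

variable {𝔤 : Type*} [LieRing 𝔤]

/-- The additive group of a Lie ideal. -/
abbrev toAddSg (A : LieIdeal ℤ 𝔤) : AddSubgroup 𝔤 := A.toSubmodule.toAddSubgroup

theorem mem_toAddSg {A : LieIdeal ℤ 𝔤} {x : 𝔤} : x ∈ toAddSg A ↔ x ∈ A := Iff.rfl

theorem toAddSg_mono {A B : LieIdeal ℤ 𝔤} (h : A ≤ B) : toAddSg A ≤ toAddSg B := h

/-- Bracketing with `x` on the left. -/
def lieLeft (x : 𝔤) : 𝔤 →+ 𝔤 := AddMonoidHom.mk' (fun y => ⁅x, y⁆) (lie_add x)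

@[simp] theorem lieLeft_apply (x y : 𝔤) : lieLeft x y = ⁅x, y⁆ := rfl

theorem mem_centraliserMod_singleton {x y : 𝔤} {N : AddSubgroup 𝔤} :
    y ∈ centraliserMod {x} N ↔ ⁅x, y⁆ ∈ N := by
  change (∀ s ∈ ({x} : Set 𝔤), ⁅s, y⁆ ∈ N) ↔ _
  simp

theorem centraliserMod_singleton (x : 𝔤) (N : AddSubgroup 𝔤) :
    centraliserMod {x} N = N.comap (lieLeft x) := by
  ext y
  rw [mem_centraliserMod_singleton]
  rfl

theorem centraliserMod_insert (x : 𝔤) (S : Set 𝔤) (N : AddSubgroup 𝔤) :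
    centraliserMod (insert x S) N = centraliserMod {x} N ⊓ centraliserMod S N := by
  ext y
  rw [AddSubgroup.mem_inf, mem_centraliserMod_singleton]
  change (∀ s ∈ insert x S, ⁅s, y⁆ ∈ N) ↔ _ ∧ (∀ s ∈ S, ⁅s, y⁆ ∈ N)
  simp

theorem relIndex_centraliserMod_singleton (x : 𝔤) (N A : AddSubgroup 𝔤) :
    (centraliserMod {x} N).relIndex A = N.relIndex (A.map (lieLeft x)) := by
  rw [centraliserMod_singleton, AddSubgroup.relIndex_comap]

theorem centraliserMod_singleton_comm (x y : 𝔤) (N : AddSubgroup 𝔤) :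
    y ∈ centraliserMod {x} N ↔ x ∈ centraliserMod {y} N := by
  rw [mem_centraliserMod_singleton, mem_centraliserMod_singleton, ← lie_skew, neg_mem_iff]

theorem relIndex_ne_zero_mono {H K K' : AddSubgroup 𝔤} (h : H.relIndex K ≠ 0) (hK : K' ≤ K) :
    H.relIndex K' ≠ 0 := fun h' => h (AddSubgroup.relIndex_eq_zero_of_le_right hK h')

theorem relIndex_ne_zero_mono_left {H H' K : AddSubgroup 𝔤} (h : H.relIndex K ≠ 0) (hH : H ≤ H') :
    H'.relIndex K ≠ 0 := fun h' => h (AddSubgroup.relIndex_eq_zero_of_le_left hH h')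

/-- The almost centraliser of `A` modulo `N`: the elements `y` for which `⁅y, A⁆` is finite
modulo `N`. -/
def almostCentralizer (A N : LieIdeal ℤ 𝔤) : LieIdeal ℤ 𝔤 where
  carrier := {y | (centraliserMod {y} (toAddSg N)).relIndex (toAddSg A) ≠ 0}
  zero_mem' := by
    have : centraliserMod {(0 : 𝔤)} (toAddSg N) = ⊤ := by
      ext x; simp [mem_centraliserMod_singleton]
    simp [this]
  add_mem' := fun {x y} hx hy => by
    refine relIndex_ne_zero_mono_left (AddSubgroup.relIndex_inf_ne_zero hx hy) ?_
    intro z hz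
    rw [AddSubgroup.mem_inf] at hz
    simp only [mem_centraliserMod_singleton] at hz ⊢
    rw [add_lie]
    exact add_mem hz.1 hz.2
  smul_mem' := fun c x hx => by
    refine relIndex_ne_zero_mono_left hx ?_
    intro z hz
    simp only [mem_centraliserMod_singleton] at hz ⊢
    rw [smul_lie]
    exact N.smul_mem c hz
  lie_mem := fun {z y} hy => by
    -- Since `⁅⁅z, y⁆, a⁆ = ⁅z, ⁅y, a⁆⁆ - ⁅y, ⁅z, a⁆⁆`, it suffices that both `a` and `⁅z, a⁆`
    -- centralise `y` modulo `N`.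
    have h₁ : ((centraliserMod {y} (toAddSg N)).comap (lieLeft z)).relIndex (toAddSg A) ≠ 0 := by
      rw [AddSubgroup.relIndex_comap]
      refine relIndex_ne_zero_mono hy ?_
      rintro _ ⟨a, ha, rfl⟩
      exact A.lie_mem ha
    refine relIndex_ne_zero_mono_left (AddSubgroup.relIndex_inf_ne_zero h₁ hy) ?_
    intro a ha
    rw [AddSubgroup.mem_inf, AddSubgroup.mem_comap, lieLeft_apply] at ha
    simp only [mem_centraliserMod_singleton] at ha ⊢
    rw [lie_lie]
    exact sub_mem (N.lie_mem ha.2) ha.1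

theorem mem_almostCentralizer {A N : LieIdeal ℤ 𝔤} {y : 𝔤} : y ∈ almostCentralizer A N ↔
    (centraliserMod {y} (toAddSg N)).relIndex (toAddSg A) ≠ 0 := Iff.rfl

theorem centralizerIdeal_le_almostCentralizer (A N : LieIdeal ℤ 𝔤) :
    centralizerIdeal A N ≤ almostCentralizer A N := by
  intro y hy
  rw [mem_almostCentralizer, AddSubgroup.relIndex_eq_one.2]
  · exact one_ne_zero
  · intro a ha
    rw [centraliserMod_singleton_comm, mem_centraliserMod_singleton]
    exact hy a ha

/-- An additive group is not a finite union of infinite-index subgroups. -/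
theorem exists_mem_forall_notMem {ι : Type*} (s : Finset ι) (A : AddSubgroup 𝔤)
    (K : ι → AddSubgroup 𝔤) (h : ∀ i ∈ s, (K i).relIndex A = 0) :
    ∃ a ∈ A, ∀ i ∈ s, a ∉ K i := by
  by_contra! hcon
  have hc : ⋃ i ∈ s, (((K i).addSubgroupOf A).toIntSubmodule : Set A) = Set.univ := by
    ext a
    obtain ⟨i, hi, ha⟩ := hcon a a.2
    simp only [Set.mem_iUnion, Set.mem_univ, iff_true]
    exact ⟨i, hi, ha⟩
  obtain ⟨i, hi, hf⟩ := Submodule.exists_finiteIndex_of_cover hc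
  exact hf.index_ne_zero (h i hi)

/-- The witness form is first-order, as definability requires, and treats infinite indices
uniformly. -/
theorem indexAtLeast_iff {H K : AddSubgroup 𝔤} {d : ℕ} : IndexAtLeast K H d ↔
    ∃ b : Fin d → 𝔤, (∀ i, b i ∈ K) ∧ ∀ i j, i ≠ j → b i - b j ∉ H := by
  constructor
  · intro h
    obtain ⟨e⟩ : Nonempty (Fin d ↪ K ⧸ H.addSubgroupOf K) := by
      by_cases h0 : H.relIndex K = 0
      · have : Infinite (K ⧸ H.addSubgroupOf K) := AddSubgroup.index_eq_zero_iff_infinite.1 h0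
        exact ⟨Fin.valEmbedding.trans (Infinite.natEmbedding _)⟩
      · have : (H.addSubgroupOf K).FiniteIndex := ⟨h0⟩
        have := Fintype.ofFinite (K ⧸ H.addSubgroupOf K)
        apply Function.Embedding.nonempty_of_card_le
        rw [Fintype.card_fin, ← Nat.card_eq_fintype_card]
        exact h.resolve_left h0
    refine ⟨fun i => ((e i).out : K), fun i => (e i).out.2,
      fun i j hij hm => hij (e.injective ?_)⟩
    rw [← QuotientAddGroup.out_eq' (e i), ← QuotientAddGroup.out_eq' (e j)]
    refine (QuotientAddGroup.eq.2 ?_).symm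
    rw [AddSubgroup.mem_addSubgroupOf]
    simpa [neg_add_eq_sub] using hm
  · rintro ⟨b, hb, hH⟩
    by_cases h0 : H.relIndex K = 0
    · exact Or.inl h0
    have : (H.addSubgroupOf K).FiniteIndex := ⟨h0⟩
    have hinj : Function.Injective
        (fun i : Fin d => ((⟨b i, hb i⟩ : K) : K ⧸ H.addSubgroupOf K)) := by
      intro i j hij
      by_contra hne
      refine hH j i (Ne.symm hne) ?_
      have := QuotientAddGroup.eq.1 hij
      rw [AddSubgroup.mem_addSubgroupOf] at this
      simpa [neg_add_eq_sub] using this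
    have h' := Nat.card_le_card_of_injective _ hinj
    rw [Nat.card_fin] at h'
    exact Or.inr h'

theorem not_indexAtLeast_iff {H K : AddSubgroup 𝔤} {d : ℕ} :
    ¬ IndexAtLeast K H d ↔ H.relIndex K ≠ 0 ∧ H.relIndex K < d := by
  rw [IndexAtLeast, not_or, not_le]

theorem not_indexAtLeast_mono {H H' K K' : AddSubgroup 𝔤} {d : ℕ} (h : ¬ IndexAtLeast K H d)
    (hK : K' ≤ K) (hH : K' ⊓ H ≤ H') : ¬ IndexAtLeast K' H' d := by
  contrapose! h
  rw [indexAtLeast_iff] at h ⊢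
  obtain ⟨b, hb, hb'⟩ := h
  exact ⟨b, fun i => hK (hb i), fun i j hij hm => hb' i j hij (hH
    (AddSubgroup.mem_inf.2 ⟨K'.sub_mem (hb i) (hb j), hm⟩))⟩

end Index
-- Bounded indices and finite brackets.
section FiniteIndex

variable {𝔤 : Type*} [LieRing 𝔤]

theorem toAddSg_lie_le {A B : LieIdeal ℤ 𝔤} {V : AddSubgroup 𝔤}
    (h : ∀ x ∈ A, ∀ y ∈ B, ⁅x, y⁆ ∈ V) : toAddSg ⁅A, B⁆ ≤ V := by
  have : (⁅A, B⁆ : LieIdeal ℤ 𝔤).toSubmodule ≤ AddSubgroup.toIntSubmodule V := by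
    rw [LieSubmodule.lieIdeal_oper_eq_linear_span', Submodule.span_le]
    rintro _ ⟨x, hx, y, hy, rfl⟩
    exact h x hx y hy
  exact this

theorem toAddSg_sup (A B : LieIdeal ℤ 𝔤) : toAddSg (A ⊔ B) = toAddSg A ⊔ toAddSg B := by
  ext x
  rw [mem_toAddSg, LieSubmodule.mem_sup, AddSubgroup.mem_sup]
  rfl

theorem exists_finset_sub_mem {H K : AddSubgroup 𝔤} (h : H.relIndex K ≠ 0) :
    ∃ T : Finset 𝔤, (∀ t ∈ T, t ∈ K) ∧ ∀ b ∈ K, ∃ t ∈ T, b - t ∈ H := by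
  classical
  have : (H.addSubgroupOf K).FiniteIndex := ⟨h⟩
  have := Fintype.ofFinite (K ⧸ H.addSubgroupOf K)
  refine ⟨Finset.univ.image fun q : K ⧸ H.addSubgroupOf K => (q.out : 𝔤), ?_, fun b hb => ?_⟩
  · intro t ht
    obtain ⟨q, -, rfl⟩ := Finset.mem_image.1 ht
    exact q.out.2
  · refine ⟨_, Finset.mem_image_of_mem _ (Finset.mem_univ ((⟨b, hb⟩ : K) : K ⧸ _)), ?_⟩
    have := QuotientAddGroup.eq.1
      (QuotientAddGroup.out_eq' ((⟨b, hb⟩ : K) : K ⧸ H.addSubgroupOf K))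
    rw [AddSubgroup.mem_addSubgroupOf] at this
    simpa [neg_add_eq_sub] using this

theorem relIndex_sup_ne_zero {N U V : AddSubgroup 𝔤} (hU : N.relIndex U ≠ 0)
    (hV : N.relIndex V ≠ 0) : N.relIndex (U ⊔ V) ≠ 0 := by
  have h₁ : N.relIndex (U ⊔ N) ≠ 0 := by rwa [AddSubgroup.relIndex_sup_right]
  have h₂ : (U ⊔ N).relIndex (V ⊔ (U ⊔ N)) ≠ 0 := by
    rw [AddSubgroup.relIndex_sup_right]
    exact relIndex_ne_zero_mono_left hV le_sup_right
  refine relIndex_ne_zero_mono (AddSubgroup.relIndex_ne_zero_trans h₁ h₂) ?_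
  exact sup_le (le_sup_left.trans le_sup_right) le_sup_left

theorem relIndex_finset_sup_ne_zero {ι : Type*} {N : AddSubgroup 𝔤} (s : Finset ι)
    (U : ι → AddSubgroup 𝔤) (h : ∀ i ∈ s, N.relIndex (U i) ≠ 0) :
    N.relIndex (s.sup U) ≠ 0 := by
  classical
  induction s using Finset.induction_on with
  | empty => simp
  | insert i s _ ih =>
    rw [Finset.sup_insert]
    exact relIndex_sup_ne_zero (h i (Finset.mem_insert_self i s))
      (ih fun j hj => h j (Finset.mem_insert_of_mem hj))

theorem le_of_relIndex_le {N U V : AddSubgroup 𝔤} (hN : N ≤ U) (hU : U ≤ V)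
    (h : N.relIndex V ≠ 0) (hle : N.relIndex V ≤ N.relIndex U) : V ≤ U := by
  rw [← AddSubgroup.relIndex_eq_one]
  have h' := AddSubgroup.relIndex_mul_relIndex N U V hN hU
  have h₀ : N.relIndex U ≠ 0 := relIndex_ne_zero_mono h hU
  have h₁ : U.relIndex V ≠ 0 := relIndex_ne_zero_mono_left h hN
  rw [← h'] at hle
  by_contra hne
  have : 2 ≤ U.relIndex V := by omega
  nlinarith [Nat.pos_of_ne_zero h₀]

theorem le_of_relIndex_le_left {U V W : AddSubgroup 𝔤} (hU : U ≤ V) (hV : V ≤ W)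
    (h : U.relIndex W ≠ 0) (hle : U.relIndex W ≤ V.relIndex W) : V ≤ U := by
  rw [← AddSubgroup.relIndex_eq_one]
  have h' := AddSubgroup.relIndex_mul_relIndex U V W hU hV
  have h₀ : V.relIndex W ≠ 0 := relIndex_ne_zero_mono_left h hU
  have h₁ : U.relIndex V ≠ 0 := relIndex_ne_zero_mono h hV
  rw [← h'] at hle
  by_contra hne
  have : 2 ≤ U.relIndex V := by omega
  nlinarith [Nat.pos_of_ne_zero h₀]

/-- If the brackets `⁅a, B⁆` with `a ∈ A` are uniformly finite modulo `N`, then almost all of `B`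
almost centralises `A` modulo `N`. -/
theorem relIndex_almostCentralizer_ne_zero {A B N : LieIdeal ℤ 𝔤} {d : ℕ}
    (h : ∀ a ∈ A, ¬ IndexAtLeast (toAddSg B) (centraliserMod {a} (toAddSg N)) d) :
    (toAddSg (almostCentralizer A N)).relIndex (toAddSg B) ≠ 0 := by
  intro h0
  -- The differences `b i - b j` have centralisers of infinite index in `A`; an `a` avoiding them
  -- all separates the `d` elements `⁅a, b i⁆` modulo `N`.
  obtain ⟨b, hb, hbN⟩ := indexAtLeast_iff.1 (Or.inl h0 : IndexAtLeast _ _ d)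
  obtain ⟨a, ha, haN⟩ := exists_mem_forall_notMem
    (Finset.univ.filter fun p : Fin d × Fin d => p.1 ≠ p.2) (toAddSg A)
    (fun p => centraliserMod {b p.1 - b p.2} (toAddSg N)) (fun p hp => by
      by_contra hne
      exact hbN p.1 p.2 (by simpa using hp) hne)
  refine h a ha (indexAtLeast_iff.2 ⟨b, hb, fun i j hij hm => ?_⟩)
  refine haN (i, j) (by simpa using hij) ?_
  rwa [centraliserMod_singleton_comm]

/-- If the brackets `⁅a, E⁆` with `a ∈ A` are uniformly finite modulo `N` and `E` almost
centralises `A` modulo `N`, then `⁅A, E⁆` is finite modulo `N`. -/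
theorem relIndex_lie_ne_zero {A E N : LieIdeal ℤ 𝔤} {d : ℕ}
    (h : ∀ a ∈ A, ¬ IndexAtLeast (toAddSg E) (centraliserMod {a} (toAddSg N)) d)
    (hE : E ≤ almostCentralizer A N) :
    (toAddSg N).relIndex (toAddSg (⁅A, E⁆ ⊔ N)) ≠ 0 := by
  let f : 𝔤 → AddSubgroup 𝔤 := fun a => (toAddSg E).map (lieLeft a)
  have hf : ∀ a ∈ A, (toAddSg N).relIndex (f a) ≠ 0 ∧ (toAddSg N).relIndex (f a) < d := by
    intro a ha
    rw [← relIndex_centraliserMod_singleton]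
    exact not_indexAtLeast_iff.1 (h a ha)
  obtain ⟨a₀, ha₀, hmax⟩ : ∃ a₀ ∈ A, ∀ a ∈ A,
      (toAddSg N).relIndex (f a) ≤ (toAddSg N).relIndex (f a₀) := by
    obtain ⟨a₀, ha₀, hmin⟩ := WellFounded.has_min
      (measure fun a => d - (toAddSg N).relIndex (f a)).wf {a | a ∈ A} ⟨0, A.zero_mem⟩
    refine ⟨a₀, ha₀, fun a ha => ?_⟩
    have h₁ : ¬ (d - (toAddSg N).relIndex (f a) < d - (toAddSg N).relIndex (f a₀)) := hmin a ha
    have h₂ := (hf a ha).2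
    omega
  let V₀ := f a₀ ⊔ toAddSg N
  obtain ⟨T, hTE, hT⟩ := exists_finset_sub_mem
    (H := centraliserMod {a₀} (toAddSg N)) (K := toAddSg E)
    (by rw [relIndex_centraliserMod_singleton]; exact (hf a₀ ha₀).1)
  let A₀ : AddSubgroup 𝔤 := ⨅ t : T, centraliserMod {(t : 𝔤)} (toAddSg N)
  have hA₀ : A₀.relIndex (toAddSg A) ≠ 0 :=
    AddSubgroup.relIndex_iInf_ne_zero fun t => hE (hTE t t.2)
  -- Elements `a` centralising `T` do not change the brackets of `a₀` with `T` modulo `N`, so `⁅a₀ +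
  -- a, E⁆ + N` contains `V₀` and, by the maximal choice of `a₀`, equals it.
  have hV₀ : ∀ a ∈ A, a ∈ A₀ → ∀ b ∈ E, ⁅a, b⁆ ∈ V₀ := by
    intro a ha haA b hb
    have hle : V₀ ≤ f (a₀ + a) ⊔ toAddSg N := by
      refine sup_le ?_ le_sup_right
      rintro _ ⟨b, hb, rfl⟩
      obtain ⟨t, htT, ht⟩ := hT b hb
      rw [mem_centraliserMod_singleton] at ht
      have hat : ⁅a, t⁆ ∈ toAddSg N := by
        have := AddSubgroup.mem_iInf.1 haA ⟨t, htT⟩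
        rwa [centraliserMod_singleton_comm, mem_centraliserMod_singleton] at this
      have : lieLeft a₀ b = ⁅a₀ + a, t⁆ + (⁅a₀, b - t⁆ - ⁅a, t⁆) := by
        simp
      rw [this]
      exact add_mem (AddSubgroup.mem_sup_left ⟨t, hTE t htT, rfl⟩)
        (AddSubgroup.mem_sup_right (sub_mem ht hat))
    have hmem := add_mem ha₀ ha
    have hle' : f (a₀ + a) ⊔ toAddSg N ≤ V₀ := by
      refine le_of_relIndex_le (N := toAddSg N) le_sup_right hle ?_ ?_
      · rw [AddSubgroup.relIndex_sup_right]
        exact (hf _ hmem).1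
      · rw [AddSubgroup.relIndex_sup_right, AddSubgroup.relIndex_sup_right]
        exact hmax _ hmem
    have h₁ : ⁅a₀ + a, b⁆ ∈ V₀ := hle' (AddSubgroup.mem_sup_left ⟨b, hb, rfl⟩)
    have h₂ : ⁅a₀, b⁆ ∈ V₀ := AddSubgroup.mem_sup_left ⟨b, hb, rfl⟩
    rw [add_lie] at h₁
    simpa using sub_mem h₁ h₂
  obtain ⟨S, hSA, hS⟩ := exists_finset_sub_mem hA₀
  have hfin : (toAddSg N).relIndex (V₀ ⊔ S.sup f) ≠ 0 := by
    refine relIndex_sup_ne_zero ?_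
      (relIndex_finset_sup_ne_zero S f fun s hs => (hf s (hSA s hs)).1)
    rw [AddSubgroup.relIndex_sup_right]
    exact (hf a₀ ha₀).1
  rw [toAddSg_sup, AddSubgroup.relIndex_sup_right]
  refine relIndex_ne_zero_mono hfin (toAddSg_lie_le fun a ha b hb => ?_)
  obtain ⟨s, hsS, hs⟩ := hS a ha
  have : ⁅a, b⁆ = ⁅a - s, b⁆ + ⁅s, b⁆ := by simp
  rw [this]
  exact add_mem (AddSubgroup.mem_sup_left (hV₀ _ (sub_mem ha (hSA s hsS)) hs b hb))
    (AddSubgroup.mem_sup_right (Finset.le_sup (f := f) hsS ⟨b, hb, rfl⟩))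

/-! ### Locally nilpotent actions on finite sections. -/

/-- Every element of `H` lies in an ideal acting nilpotently. -/
def LocallyActsNilpotently (H : LieIdeal ℤ 𝔤) : Prop :=
  ∀ x ∈ H, ∃ I : LieIdeal ℤ 𝔤, ActsNilpotently I ∧ x ∈ I

theorem LocallyActsNilpotently.mono {H H' : LieIdeal ℤ 𝔤} (hH : LocallyActsNilpotently H)
    (h : H' ≤ H) : LocallyActsNilpotently H' := fun x hx => hH x (h hx)

theorem actsNilpotently_bot : ActsNilpotently (⊥ : LieIdeal ℤ 𝔤) :=
  ⟨1, by rw [iterLie_succ, LieSubmodule.bot_lie]⟩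

theorem LocallyActsNilpotently.exists_subset {H : LieIdeal ℤ 𝔤} (hH : LocallyActsNilpotently H)
    {X : Set 𝔤} (hX : X.Finite) (hXH : X ⊆ H) :
    ∃ K ≤ H, ActsNilpotently K ∧ X ⊆ K := by
  induction X, hX using Set.Finite.induction_on with
  | empty => exact ⟨⊥, bot_le, actsNilpotently_bot, Set.empty_subset _⟩
  | @insert x X _ _ ih =>
    obtain ⟨K, hKH, hK, hXK⟩ := ih ((Set.subset_insert _ _).trans hXH)
    have hx : x ∈ H := hXH (Set.mem_insert _ _)
    obtain ⟨I, hI, hxI⟩ := hH x hx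
    refine ⟨K ⊔ (I ⊓ H), sup_le hKH inf_le_right, hK.sup (hI.mono inf_le_left), ?_⟩
    rw [Set.insert_subset_iff]
    have h₁ : I ⊓ H ≤ K ⊔ (I ⊓ H) := le_sup_right
    have h₂ : K ≤ K ⊔ (I ⊓ H) := le_sup_left
    exact ⟨h₁ ⟨hxI, hx⟩, fun y hy => h₂ (hXK hy)⟩

/-- Choose `K` with `⁅K, V⁆ ⊔ N` of least index in `V`; enlarging `K` by an ideal containing a given
`x ∈ H` adds nothing. -/
theorem exists_le_lie_sup {H V N : LieIdeal ℤ 𝔤} (hH : LocallyActsNilpotently H) (hNV : N ≤ V)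
    (h : (toAddSg N).relIndex (toAddSg V) ≠ 0) :
    ∃ K ≤ H, ActsNilpotently K ∧ ⁅H, V⁆ ≤ ⁅K, V⁆ ⊔ N := by
  let r : LieIdeal ℤ 𝔤 → ℕ := fun K => (toAddSg (⁅K, V⁆ ⊔ N)).relIndex (toAddSg V)
  obtain ⟨K, ⟨hKH, hK⟩, hmin⟩ := WellFounded.has_min (measure r).wf
    {K | K ≤ H ∧ ActsNilpotently K} ⟨⊥, bot_le, actsNilpotently_bot⟩
  refine ⟨K, hKH, hK, ?_⟩
  rw [LieSubmodule.lie_le_iff]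
  intro x hx v hv
  obtain ⟨I, hIH, hI, hxI⟩ := hH.exists_subset (Set.finite_singleton x) (by simpa using hx)
  have hle : ⁅K, V⁆ ⊔ N ≤ ⁅K ⊔ I, V⁆ ⊔ N :=
    sup_le_sup (LieSubmodule.mono_lie_left _ le_sup_left) le_rfl
  have hr : r K ≤ r (K ⊔ I) := not_lt.1 (hmin (K ⊔ I) ⟨sup_le hKH hIH, hK.sup hI⟩)
  have hV : toAddSg (⁅K ⊔ I, V⁆ ⊔ N) ≤ toAddSg V :=
    toAddSg_mono (sup_le (LieSubmodule.lie_le_right _ _) hNV)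
  have hle' := le_of_relIndex_le_left (toAddSg_mono hle) hV
    (relIndex_ne_zero_mono_left h (toAddSg_mono le_sup_right)) hr
  have hI' : I ≤ K ⊔ I := le_sup_right
  exact hle' (LieSubmodule.mem_sup_left (LieSubmodule.lie_mem_lie (hI' (hxI rfl)) hv))

/-- `H` acts nilpotently on finite sections. -/
theorem exists_iterLie_le_of_relIndex_ne_zero {H N : LieIdeal ℤ 𝔤}
    (hH : LocallyActsNilpotently H) (n : ℕ) : ∀ V : LieIdeal ℤ 𝔤, N ≤ V →
      (toAddSg N).relIndex (toAddSg V) ≠ 0 → (toAddSg N).relIndex (toAddSg V) ≤ n →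
      ∃ s, iterLie H V s ≤ N := by
  induction n with
  | zero => exact fun V _ h h' => absurd (Nat.le_zero.1 h') h
  | succ n ih =>
    intro V hNV h hn
    have hUV : ⁅H, V⁆ ⊔ N ≤ V := sup_le (LieSubmodule.lie_le_right _ _) hNV
    -- In the case of equality a nilpotently acting `K` already gives `V = ⁅K, V⁆ ⊔ N`, and
    -- iterating yields `V ≤ N`. Otherwise the index drops.
    by_cases hVU : V ≤ ⁅H, V⁆ ⊔ N
    · obtain ⟨K, hKH, ⟨m, hm⟩, hK⟩ := exists_le_lie_sup hH hNV h
      have hVK : V ≤ ⁅K, V⁆ ⊔ N := hVU.trans (sup_le hK le_sup_right)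
      have hV : ∀ m, V ≤ iterLie K V m ⊔ N := by
        intro m
        induction m with
        | zero => exact le_sup_left
        | succ m ihm =>
          refine hVK.trans (sup_le ((LieSubmodule.mono_lie_right _ ihm).trans ?_) le_sup_right)
          rw [LieSubmodule.lie_sup]
          exact sup_le_sup le_rfl (LieSubmodule.lie_le_right _ _)
      refine ⟨0, (hV m).trans (sup_le ?_ le_rfl)⟩
      exact ((iterLie_mono le_rfl le_top m).trans hm).trans bot_le
    · have hU := relIndex_ne_zero_mono h (toAddSg_mono hUV)
      have hlt : (toAddSg N).relIndex (toAddSg (⁅H, V⁆ ⊔ N)) ≤ n := by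
        by_contra! hcon
        exact hVU (le_of_relIndex_le (toAddSg_mono le_sup_right) (toAddSg_mono hUV) h
          (by omega))
      obtain ⟨s, hs⟩ := ih _ le_sup_right hU hlt
      refine ⟨s + 1, ?_⟩
      rw [iterLie_succ']
      exact (iterLie_mono le_rfl le_sup_left s).trans hs

theorem LocallyActsNilpotently.exists_iterLie_le {H V N : LieIdeal ℤ 𝔤}
    (hH : LocallyActsNilpotently H) (hNV : N ≤ V)
    (h : (toAddSg N).relIndex (toAddSg V) ≠ 0) : ∃ s, iterLie H V s ≤ N :=
  exists_iterLie_le_of_relIndex_ne_zero hH _ V hNV h le_rfl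

end FiniteIndex
-- Consequences of the chain condition.
section ChainCondition

variable {𝔤 : Type*} [LieRing 𝔤]

/-- A family of additive subgroups satisfying the chain condition on centralisers up to bounded
index, closed under finite extensions and under almost centralisers of bounded index. -/
structure IsChainFamily (D : AddSubgroup 𝔤 → Prop) : Prop where
  chain : ∀ N, D N → ∃ n d : ℕ, ¬ ∃ g : Fin n → 𝔤, ∀ i : Fin n,
    IndexAtLeast (centraliserMod (g '' {j | j < i}) N) (centraliserMod (g '' {j | j ≤ i}) N) d
  bot : D ⊥
  of_relIndex_ne_zero : ∀ N W, D N → N ≤ W → N.relIndex W ≠ 0 → D W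
  bounded : ∀ (N A : AddSubgroup 𝔤) (X : Set 𝔤) (d : ℕ), D N → X.Finite →
    (∀ x, x ∈ A ↔ ¬ IndexAtLeast (centraliserMod X N) (centraliserMod {x} N) d) → D A

/-- If `T ∅` failed, failing sets could be extended forever by elements with index drop at least
`d`; the first `n` of these contradict the chain condition. -/
theorem IsChainFamily.induction {D : AddSubgroup 𝔤 → Prop} (hD : IsChainFamily D)
    {N : AddSubgroup 𝔤} (hN : D N) : ∃ d : ℕ, ∀ T : Set 𝔤 → Prop,
      (∀ S, (∀ g, IndexAtLeast (centraliserMod S N) (centraliserMod (insert g S) N) d →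
        T (insert g S)) → T S) → T ∅ := by
  obtain ⟨n, d, hnd⟩ := hD.chain N hN
  refine ⟨d, fun T hT => ?_⟩
  by_contra h0
  have hstep : ∀ S : {S : Set 𝔤 // ¬ T S}, ∃ g, IndexAtLeast (centraliserMod S.1 N)
      (centraliserMod (insert g S.1) N) d ∧ ¬ T (insert g S.1) := by
    intro S
    by_contra! hcon
    exact S.2 (hT S.1 hcon)
  choose e he₁ he₂ using hstep
  let next : {S : Set 𝔤 // ¬ T S} → {S : Set 𝔤 // ¬ T S} := fun S => ⟨insert (e S) S.1, he₂ S⟩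
  let S : ℕ → {S : Set 𝔤 // ¬ T S} := fun m => next^[m] ⟨∅, h0⟩
  have hS : ∀ m, (S (m + 1)).1 = insert (e (S m)) (S m).1 := by
    intro m
    change (next^[m + 1] _).1 = _
    rw [Function.iterate_succ_apply']
  have himg : ∀ m, (S m).1 = (fun j => e (S j)) '' {j | j < m} := by
    intro m
    induction m with
    | zero => simp [S]
    | succ m ih =>
      rw [hS, ih]
      refine (Set.image_insert_eq (f := fun j => e (S j))).symm.trans (congrArg _ ?_)
      ext j
      simp only [Set.mem_insert_iff, Set.mem_ofPred_eq]
      omega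
  refine hnd ⟨fun j => e (S j), fun i => ?_⟩
  have h₁ : (fun j : Fin n => e (S j)) '' {j | j < i} = (S i).1 := by
    rw [himg]
    ext x
    constructor
    · rintro ⟨j, hj, rfl⟩
      exact ⟨j, hj, rfl⟩
    · rintro ⟨j, hj, rfl⟩
      have hj' : j < (i : ℕ) := hj
      exact ⟨⟨j, hj'.trans i.2⟩, hj', rfl⟩
  have h₂ : (fun j : Fin n => e (S j)) '' {j | j ≤ i} = insert (e (S i)) (S i).1 := by
    rw [← h₁]
    have : {j : Fin n | j ≤ i} = insert i {j | j < i} := by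
      ext j
      simp [le_iff_eq_or_lt]
    rw [this, Set.image_insert_eq]
  rw [h₁, h₂]
  exact he₁ (S i)

/-- Elements of `P` with a large index drop are added until none is left. -/
theorem IsChainFamily.exists_finite {D : AddSubgroup 𝔤 → Prop} (hD : IsChainFamily D)
    {N : AddSubgroup 𝔤} (hN : D N) (P : Set 𝔤) : ∃ (d : ℕ) (X : Set 𝔤), X.Finite ∧ X ⊆ P ∧
      ∀ f ∈ P, ¬ IndexAtLeast (centraliserMod X N) (centraliserMod {f} N) d := by
  obtain ⟨d, hd⟩ := hD.induction hN
  refine ⟨d, hd (fun S => S.Finite → S ⊆ P → ∃ X : Set 𝔤, X.Finite ∧ X ⊆ P ∧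
    ∀ f ∈ P, ¬ IndexAtLeast (centraliserMod X N) (centraliserMod {f} N) d) ?_ Set.finite_empty
    (Set.empty_subset _)⟩
  intro S hS hfin hSP
  by_cases h : ∀ f ∈ P, ¬ IndexAtLeast (centraliserMod S N) (centraliserMod {f} N) d
  · exact ⟨S, hfin, hSP, h⟩
  · push Not at h
    obtain ⟨f, hf, hfS⟩ := h
    refine hS f ?_ (hfin.insert f) (Set.insert_subset hf hSP)
    by_contra hcon
    refine not_indexAtLeast_mono hcon le_rfl ?_ hfS
    rw [centraliserMod_insert]
    exact inf_le_right.trans inf_le_left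

theorem relIndex_centraliserMod_ne_zero {N : AddSubgroup 𝔤} {J : AddSubgroup 𝔤} {X : Set 𝔤}
    (hX : X.Finite) (h : ∀ x ∈ X, (centraliserMod {x} N).relIndex J ≠ 0) :
    (centraliserMod X N).relIndex J ≠ 0 := by
  induction X, hX using Set.Finite.induction_on with
  | empty =>
    have : centraliserMod ∅ N = ⊤ := by
      ext x
      exact ⟨fun _ => AddSubgroup.mem_top _, fun _ s hs => hs.elim⟩
    simp [this]
  | @insert x X _ _ ih =>
    rw [centraliserMod_insert]
    exact AddSubgroup.relIndex_inf_ne_zero (h x (Set.mem_insert _ _))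
      (ih fun y hy => h y (Set.mem_insert_of_mem _ hy))

/-- Almost centralisers of ideals modulo members of the family belong to the family, and the
indices in their definition are bounded. -/
theorem IsChainFamily.almostCentralizer_mem {D : AddSubgroup 𝔤 → Prop} (hD : IsChainFamily D)
    {N : LieIdeal ℤ 𝔤} (hN : D (toAddSg N)) (J : LieIdeal ℤ 𝔤) :
    D (toAddSg (almostCentralizer J N)) ∧ ∃ d : ℕ, ∀ x ∈ almostCentralizer J N,
      ¬ IndexAtLeast (toAddSg J) (centraliserMod {x} (toAddSg N)) d := by
  -- As `X` is taken inside the almost centraliser, `E` has finite index in `J`. Index below `d` in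
  -- `E`, a definable condition, is then equivalent to finite index in `J`.
  obtain ⟨d, X, hX, hXP, hbd⟩ := hD.exists_finite hN (almostCentralizer J N : Set 𝔤)
  set E := centraliserMod X (toAddSg N)
  have hE : E.relIndex (toAddSg J) ≠ 0 := relIndex_centraliserMod_ne_zero hX fun x hx => hXP hx
  refine ⟨hD.bounded _ _ X d hN hX fun x => ⟨hbd x, fun h => ?_⟩,
    d * E.relIndex (toAddSg J) + 1, fun x hx => ?_⟩
  · exact AddSubgroup.relIndex_ne_zero_trans (not_indexAtLeast_iff.1 h).1 hE
  · rw [not_indexAtLeast_iff]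
    refine ⟨hx, Nat.lt_succ_of_le ?_⟩
    obtain ⟨h₁, h₂⟩ := not_indexAtLeast_iff.1 (hbd x hx)
    calc (centraliserMod {x} (toAddSg N)).relIndex (toAddSg J)
        ≤ (centraliserMod {x} (toAddSg N) ⊓ E).relIndex (toAddSg J) :=
          AddSubgroup.relIndex_le_of_le_left inf_le_left (AddSubgroup.relIndex_inf_ne_zero hx hE)
      _ = (centraliserMod {x} (toAddSg N)).relIndex (E ⊓ toAddSg J) * E.relIndex (toAddSg J) :=
          (AddSubgroup.relIndex_inf_mul_relIndex _ _ _).symm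
      _ ≤ d * E.relIndex (toAddSg J) := by
          gcongr
          exact (AddSubgroup.relIndex_le_of_le_right inf_le_left h₁).trans h₂.le

/-- For a suitable finite subset `X` of `H`, the ideal `H` acts nilpotently on the centraliser
modulo `N` of any ideal of `H` containing `X`. -/
theorem IsChainFamily.exists_iterLie_centralizerIdeal_le {D : AddSubgroup 𝔤 → Prop}
    (hD : IsChainFamily D) {N H : LieIdeal ℤ 𝔤} (hN : D (toAddSg N))
    (hH : LocallyActsNilpotently H) : ∃ X : Set 𝔤, X.Finite ∧ X ⊆ H ∧
      ∀ K : LieIdeal ℤ 𝔤, X ⊆ K → ∃ t, iterLie H (centralizerIdeal K N) t ≤ N := by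
  obtain ⟨d, X, hX, hXH, hbd⟩ := hD.exists_finite hN (H : Set 𝔤)
  refine ⟨X, hX, hXH, fun K hXK => ?_⟩
  set C := centralizerIdeal K N
  have hCX : toAddSg C ≤ centraliserMod X (toAddSg N) := fun y hy s hs => hy s (hXK hs)
  have hb : ∀ a ∈ H, ¬ IndexAtLeast (toAddSg C) (centraliserMod {a} (toAddSg N)) d :=
    fun a ha => not_indexAtLeast_mono (hbd a ha) hCX inf_le_right
  set C' := C ⊓ almostCentralizer H N
  have hC' : (toAddSg C').relIndex (toAddSg C) ≠ 0 := by
    have h := relIndex_almostCentralizer_ne_zero hb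
    rw [← AddSubgroup.inf_relIndex_right, inf_comm] at h
    exact h
  -- `H` acts nilpotently on the finite sections `C / C'` and `(⁅H, C'⁆ ⊔ N) / N`; one bracket joins
  -- them.
  obtain ⟨s₁, hs₁⟩ := hH.exists_iterLie_le inf_le_left hC'
  have hb' : ∀ a ∈ H, ¬ IndexAtLeast (toAddSg C') (centraliserMod {a} (toAddSg N)) d :=
    fun a ha => not_indexAtLeast_mono (hb a ha) (toAddSg_mono inf_le_left) inf_le_right
  obtain ⟨s₂, hs₂⟩ := hH.exists_iterLie_le le_sup_right (relIndex_lie_ne_zero hb' inf_le_right)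
  have h₁ : iterLie H C' 1 ≤ ⁅H, C'⁆ ⊔ N := le_sup_left
  exact ⟨_, iterLie_trans (iterLie_trans hs₁ h₁) hs₂⟩

/-- If `H` acts nilpotently on itself modulo `J`, then `H` acts nilpotently on the almost
centraliser of `J` modulo `N`. -/
theorem IsChainFamily.exists_iterLie_almostCentralizer_le {D : AddSubgroup 𝔤 → Prop}
    (hD : IsChainFamily D) {N H J : LieIdeal ℤ 𝔤} (hN : D (toAddSg N))
    (hH : LocallyActsNilpotently H) {s : ℕ} (hs : iterLie H H s ≤ J) :
    ∃ r, iterLie H (almostCentralizer J N) r ≤ N := by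
  set A := almostCentralizer J N
  obtain ⟨-, d, hd⟩ := hD.almostCentralizer_mem hN J
  -- On `J'` the bracket with `A` is finite modulo `N`. Modulo the resulting `W`, deep brackets of
  -- an ideal by `H` fall into `J'` and centralise `A`.
  set J' := J ⊓ almostCentralizer A N
  have hJ' : (toAddSg J').relIndex (toAddSg J) ≠ 0 := by
    have h := relIndex_almostCentralizer_ne_zero hd
    rw [← AddSubgroup.inf_relIndex_right, inf_comm] at h
    exact h
  obtain ⟨s₁, hs₁⟩ := hH.exists_iterLie_le inf_le_left hJ'
  have hd' : ∀ a ∈ A, ¬ IndexAtLeast (toAddSg J') (centraliserMod {a} (toAddSg N)) d :=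
    fun a ha => not_indexAtLeast_mono (hd a ha) (toAddSg_mono inf_le_left) inf_le_right
  have hfin := relIndex_lie_ne_zero hd' inf_le_right
  set W := ⁅A, J'⁆ ⊔ N
  obtain ⟨s₂, hs₂⟩ := hH.exists_iterLie_le le_sup_right hfin
  have hW : D (toAddSg W) := hD.of_relIndex_ne_zero _ _ hN (toAddSg_mono le_sup_right) hfin
  obtain ⟨X, hX, hXH, hXK⟩ := hD.exists_iterLie_centralizerIdeal_le hW hH
  obtain ⟨K, hKH, ⟨m, hm⟩, hXK'⟩ := hH.exists_subset hX hXH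
  obtain ⟨t, ht⟩ := hXK K hXK'
  have hK : ⁅iterLie H K (s₁ + s), A⁆ ≤ W := by
    have : iterLie H K (s₁ + s) ≤ J' := iterLie_trans ((iterLie_mono le_rfl hKH s).trans hs) hs₁
    refine (LieSubmodule.mono_lie_left _ this).trans ?_
    rw [LieSubmodule.lie_comm]
    exact le_sup_left
  obtain ⟨r, hr⟩ := exists_iterLie_le_of_centralizerIdeal ht hK m A le_rfl
    (((iterLie_mono le_rfl le_top m).trans hm).trans bot_le)
  exact ⟨_, iterLie_trans hr hs₂⟩

/-- The `t` layers of the action of `J` are climbed by almost centralisers, which stay in the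
family; `H` acts nilpotently on each layer. -/
theorem IsChainFamily.actsNilpotently_of_iterLie_le {D : AddSubgroup 𝔤 → Prop}
    (hD : IsChainFamily D) {H J : LieIdeal ℤ 𝔤} (hH : LocallyActsNilpotently H)
    (hJ : ActsNilpotently J) {s : ℕ} (hs : iterLie H H s ≤ J) : ActsNilpotently H := by
  have key : ∀ t : ℕ, ∀ N : LieIdeal ℤ 𝔤, D (toAddSg N) → iterLie J ⊤ t ≤ N →
      ∃ r, iterLie H ⊤ r ≤ N := by
    intro t
    induction t with
    | zero => exact fun N _ h => ⟨0, h⟩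
    | succ t ih =>
      intro N hN h
      obtain ⟨r, hr⟩ := ih (almostCentralizer J N) (hD.almostCentralizer_mem hN J).1
        ((le_centralizerIdeal_iff.2 h).trans (centralizerIdeal_le_almostCentralizer J N))
      obtain ⟨r', hr'⟩ := hD.exists_iterLie_almostCentralizer_le hN hH hs
      exact ⟨_, iterLie_trans hr hr'⟩
  obtain ⟨t, ht⟩ := hJ
  exact key t ⊥ hD.bot ht

/-- If `H` is not contained in `N`, some element of `H` outside of `N` is centralised by `H`
modulo `N`. -/
theorem IsChainFamily.exists_mem_notMem {D : AddSubgroup 𝔤 → Prop}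
    (hD : IsChainFamily D) {N H : LieIdeal ℤ 𝔤} (hN : D (toAddSg N))
    (hH : LocallyActsNilpotently H) (hHN : ¬ H ≤ N) :
    ∃ h ∈ H, h ∉ N ∧ ∀ x ∈ H, ⁅h, x⁆ ∈ N := by
  obtain ⟨h₀, hh₀, hh₀N⟩ := SetLike.not_le_iff_exists.1 hHN
  obtain ⟨X, hX, hXH, hXK⟩ := hD.exists_iterLie_centralizerIdeal_le hN hH
  obtain ⟨K, hKH, ⟨m, hm⟩, hXK'⟩ := hH.exists_subset (hX.insert h₀)
    (Set.insert_subset hh₀ hXH)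
  rw [Set.insert_subset_iff] at hXK'
  obtain ⟨t, ht⟩ := hXK K hXK'.2
  -- The last term of the `K`-series outside `N` centralises `K` modulo `N`, so `H` acts nilpotently
  -- on it; the last term of its `H`-series outside `N` supplies `h`.
  obtain ⟨j, hj, hj'⟩ := exists_iterLie_not_le
    (((iterLie_mono le_rfl (le_top : K ≤ ⊤) m).trans hm).trans bot_le : iterLie K K m ≤ N)
    (fun h => hh₀N (h hXK'.1))
  obtain ⟨i, hi, hi'⟩ := exists_iterLie_not_le
    ((iterLie_mono le_rfl (le_centralizerIdeal_iff.2 hj') t).trans ht) hj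
  obtain ⟨h, hh, hhN⟩ := SetLike.not_le_iff_exists.1 hi
  refine ⟨h, hKH (iterLie_le _ _ _ (iterLie_le _ _ _ hh)), hhN, fun x hx => ?_⟩
  rw [← lie_skew]
  exact neg_mem ((LieSubmodule.lie_le_iff _ _ _).1 hi' x hx h hh)

/-- By the Jacobi identity, `⁅h, ⁅x, y⁆⁆` lies in `⁅N, H⁆`, hence in the finite `V`. -/
theorem relIndex_centraliserMod_lie_ne_zero {H N V : LieIdeal ℤ 𝔤} {h : 𝔤}
    (hhH : ∀ x ∈ H, ⁅h, x⁆ ∈ N)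
    (hV : (toAddSg (⊥ : LieIdeal ℤ 𝔤)).relIndex (toAddSg V) ≠ 0) (hNV : ⁅N, H⁆ ≤ V) :
    (centraliserMod {h} ⊥).relIndex (toAddSg ⁅H, H⁆) ≠ 0 := by
  rw [relIndex_centraliserMod_singleton]
  refine relIndex_ne_zero_mono hV ?_
  rw [AddSubgroup.map_le_iff_le_comap]
  refine toAddSg_lie_le fun x hx y hy => ?_
  rw [AddSubgroup.mem_comap, lieLeft_apply, leibniz_lie]
  refine add_mem (hNV (LieSubmodule.lie_mem_lie (hhH x hx) hy)) ?_
  rw [← lie_skew]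
  exact neg_mem (hNV (LieSubmodule.lie_mem_lie (hhH y hy) hx))

/-- An ideal each of whose elements lies in an ideal acting nilpotently acts nilpotently. -/
theorem IsChainFamily.actsNilpotently {D : AddSubgroup 𝔤 → Prop} (hD : IsChainFamily D)
    {F : LieIdeal ℤ 𝔤} (hF : LocallyActsNilpotently F) : ActsNilpotently F := by
  have hbot : toAddSg (⊥ : LieIdeal ℤ 𝔤) = ⊥ := rfl
  have hDbot : D (toAddSg (⊥ : LieIdeal ℤ 𝔤)) := hD.bot
  obtain ⟨d, hd⟩ := hD.induction hD.bot
  refine hd (fun S => ∀ H : LieIdeal ℤ 𝔤, LocallyActsNilpotently H →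
    (centraliserMod S ⊥).relIndex (toAddSg H) ≠ 0 → ActsNilpotently H) ?_ F hF ?_
  · intro S ih H hH hS
    set A := almostCentralizer H ⊥
    obtain ⟨hA, d', hd'⟩ := hD.almostCentralizer_mem hDbot H
    set H' := H ⊓ almostCentralizer A ⊥
    have hH' : (toAddSg H').relIndex (toAddSg H) ≠ 0 := by
      have h := relIndex_almostCentralizer_ne_zero hd'
      rw [← AddSubgroup.inf_relIndex_right, inf_comm] at h
      exact h
    have hH'H : H' ≤ H := inf_le_left
    obtain ⟨s₁, hs₁⟩ := hH.exists_iterLie_le hH'H hH'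
    have hfin := relIndex_lie_ne_zero (fun a ha =>
      not_indexAtLeast_mono (hd' a ha) (toAddSg_mono hH'H) inf_le_right) inf_le_right
    set V := ⁅A, H'⁆ ⊔ ⊥
    have hAV : ⁅A, H'⁆ ≤ V := le_sup_left
    -- The extension criterion is used twice, from `⁅H', H'⁆` to `H'` and from `H'` to `H`.
    suffices hJ : ActsNilpotently ⁅H', H'⁆ from
      hD.actsNilpotently_of_iterLie_le hH
        (hD.actsNilpotently_of_iterLie_le (s := 1) (hH.mono hH'H) hJ le_rfl) hs₁
    have hJH : ⁅H', H'⁆ ≤ H := (LieSubmodule.lie_le_left _ _).trans hH'H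
    by_cases hHA : H ≤ A
    · obtain ⟨s, hs⟩ := hH.exists_iterLie_le bot_le hfin
      have hJV : ⁅H', H'⁆ ≤ V := (LieSubmodule.mono_lie_left _ (hH'H.trans hHA)).trans hAV
      refine ⟨s + 1, ?_⟩
      rw [iterLie_succ']
      refine (iterLie_mono hJH ?_ s).trans hs
      exact (LieSubmodule.lie_le_left _ _).trans hJV
    -- Adding `h` to `S` drops the index infinitely, because `h ∉ A` while `centraliserMod S ⊥` has
    -- finite index in `H`. But `h` almost centralises `⁅H', H'⁆`, so the induction applies to that
    -- ideal.
    · obtain ⟨h, hhH, hhA, hhc⟩ := hD.exists_mem_notMem hA hH hHA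
      have hinf : (centraliserMod {h} ⊥).relIndex (toAddSg H) = 0 := by
        by_contra hne
        exact hhA hne
      refine ih h (Or.inl ?_) _ (hH.mono hJH) ?_
      · by_contra hne
        refine relIndex_ne_zero_mono_left (AddSubgroup.relIndex_ne_zero_trans hne hS) ?_ hinf
        rw [centraliserMod_insert]
        exact inf_le_left
      · rw [centraliserMod_insert]
        refine AddSubgroup.relIndex_inf_ne_zero ?_ (relIndex_ne_zero_mono hS (toAddSg_mono hJH))
        exact relIndex_centraliserMod_lie_ne_zero (fun x hx => hhc x (hH'H hx)) hfin hAV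
  · exact relIndex_centraliserMod_ne_zero Set.finite_empty fun x hx => hx.elim

end ChainCondition
end LieRing

/-! ### Definable subgroups form a chain family. -/

section DefinableRelations

variable {L : FirstOrder.Language.{u, v}} {M : Type w} [L.Structure M] {k : ℕ}
  {G : Set (Fin k → M)}

theorem Set.Definable.of_eq {α : Type*} {S T : Set (α → M)} (h : S = T)
    (hS : (Set.univ : Set M).Definable L S) : (Set.univ : Set M).Definable L T := h ▸ hS

/-- A relation on `G` is definable if it is definable as a subset of a power of `M`. -/
def IsDefinableRel (L : FirstOrder.Language.{u, v}) {M : Type w} [L.Structure M] {k : ℕ}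
    {G : Set (Fin k → M)} {α : Type} (P : (α → G) → Prop) : Prop :=
  (Set.univ : Set M).Definable L {p : α × Fin k → M |
    ∃ h : ∀ a, (fun i => p (a, i)) ∈ G, P fun a => ⟨fun i => p (a, i), h a⟩}

namespace IsDefinableRel

variable {α β : Type}

theorem congr {P Q : (α → G) → Prop} (hP : IsDefinableRel L P) (h : ∀ x, P x ↔ Q x) :
    IsDefinableRel L Q := by
  have : P = Q := funext fun x => propext (h x)
  rwa [← this]

theorem and {P Q : (α → G) → Prop} (hP : IsDefinableRel L P) (hQ : IsDefinableRel L Q) :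
    IsDefinableRel L fun x => P x ∧ Q x := by
  refine Set.Definable.of_eq ?_ (Set.Definable.inter hP hQ)
  ext p
  exact ⟨fun h => ⟨h.1.1, h.1.2, h.2.2⟩, fun h => ⟨⟨h.1, h.2.1⟩, ⟨h.1, h.2.2⟩⟩⟩

/-- Complements and pullbacks must be cut down to tuples with entries in `G`. -/
theorem definable_domain [Finite α] (hG : (Set.univ : Set M).Definable L G) :
    (Set.univ : Set M).Definable L {p : α × Fin k → M | ∀ a, (fun i => p (a, i)) ∈ G} := by
  refine Set.Definable.of_eq ?_ (Set.definable_iInter_of_finite fun a : α =>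
    hG.preimage_comp fun i => (a, i))
  ext p
  simp only [Set.mem_iInter, Set.mem_preimage]
  rfl

theorem not [Finite α] (hG : (Set.univ : Set M).Definable L G) {P : (α → G) → Prop}
    (hP : IsDefinableRel L P) : IsDefinableRel L fun x => ¬ P x := by
  refine Set.Definable.of_eq ?_ (Set.Definable.sdiff (definable_domain hG) hP)
  ext p
  exact ⟨fun h => ⟨h.1, fun h' => h.2 ⟨h.1, h'⟩⟩, fun h => ⟨h.1, fun h' => h.2 h'.2⟩⟩

theorem forall_finite [Finite α] (hG : (Set.univ : Set M).Definable L G) {ι : Type*} [Finite ι]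
    {P : ι → (α → G) → Prop} (hP : ∀ i, IsDefinableRel L (P i)) :
    IsDefinableRel L fun x => ∀ i, P i x := by
  refine Set.Definable.of_eq ?_
    (Set.Definable.inter (definable_domain hG) (Set.definable_iInter_of_finite hP))
  ext p
  simp only [Set.mem_inter_iff, Set.mem_iInter]
  exact ⟨fun h => ⟨h.1, fun i => (h.2 i).2⟩, fun h => ⟨h.1, fun i => ⟨h.1, h.2 i⟩⟩⟩

theorem comp [Finite β] (hG : (Set.univ : Set M).Definable L G) {P : (α → G) → Prop}
    (hP : IsDefinableRel L P) (f : α → β) : IsDefinableRel L fun y : β → G => P (y ∘ f) := by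
  refine Set.Definable.of_eq ?_
    (Set.Definable.inter (definable_domain hG) (hP.preimage_comp (Prod.map f id)))
  ext p
  exact ⟨fun h => ⟨h.1, h.2.2⟩, fun h => ⟨h.1, fun a => h.1 (f a), h.2⟩⟩

theorem ex [Finite α] [Finite β] {P : (α ⊕ β → G) → Prop} (hP : IsDefinableRel L P) :
    IsDefinableRel L fun x : α → G => ∃ y : β → G, P (Sum.elim x y) := by
  refine Set.Definable.of_eq ?_
    (Set.Definable.image_comp hP (fun p : α × Fin k => ((Sum.inl p.1, p.2) : (α ⊕ β) × Fin k)))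
  ext p
  constructor
  · rintro ⟨q, ⟨h, hq⟩, rfl⟩
    refine ⟨fun a => h (Sum.inl a), fun b => ⟨fun i => q (Sum.inr b, i), h (Sum.inr b)⟩, ?_⟩
    refine (congr_arg P ?_).mp hq
    ext c : 1
    rcases c with a | b <;> rfl
  · rintro ⟨h, y, hy⟩
    refine ⟨fun c => Sum.elim (fun a i => p (a, i)) (fun b => (y b : Fin k → M)) c.1 c.2,
      ⟨?_, ?_⟩, rfl⟩
    · rintro (a | b)
      · exact h a
      · exact (y b).2
    · refine (congr_arg P ?_).mp hy
      ext c : 1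
      rcases c with a | b <;> rfl

theorem eq_const (g : G) : IsDefinableRel L fun x : Fin 1 → G => x 0 = g := by
  refine Set.Definable.of_eq ?_ (Set.definable_iInter_of_finite fun i : Fin k =>
    (Set.Definable.singleton_of_mem L (Set.mem_univ ((g : Fin k → M) i))).preimage_comp
      fun _ => ((0 : Fin 1), i))
  ext p
  simp only [Set.mem_iInter, Set.mem_preimage]
  constructor
  · intro h
    have hp : ∀ a : Fin 1, (fun i => p (a, i)) = (g : Fin k → M) := by
      intro a
      rw [Subsingleton.elim a 0]
      exact funext fun i => h i
    exact ⟨fun a => by rw [hp a]; exact g.2, Subtype.ext (hp 0)⟩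
  · rintro ⟨h, hp⟩ i
    exact congr_fun (congr_arg Subtype.val hp) i

theorem of_ternary {f : G → G → G} (hf : (Set.univ : Set M).Definable L
    {p : Fin 3 × Fin k → M | ∃ x y : G, (fun i => p (0, i)) = (x : Fin k → M) ∧
      (fun i => p (1, i)) = (y : Fin k → M) ∧ (fun i => p (2, i)) = (f x y : Fin k → M)}) :
    IsDefinableRel L fun x : Fin 3 → G => x 2 = f (x 0) (x 1) := by
  refine Set.Definable.of_eq ?_ hf
  ext p
  constructor
  · rintro ⟨x, y, hx, hy, hxy⟩
    have h : ∀ a : Fin 3, (fun i => p (a, i)) ∈ G := by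
      intro a
      fin_cases a
      · exact hx ▸ x.2
      · exact hy ▸ y.2
      · exact hxy ▸ (f x y).2
    refine ⟨h, ?_⟩
    have hx' : (⟨_, h 0⟩ : G) = x := Subtype.ext hx
    have hy' : (⟨_, h 1⟩ : G) = y := Subtype.ext hy
    change _ = f ⟨_, h 0⟩ ⟨_, h 1⟩
    rw [hx', hy']
    exact Subtype.ext hxy
  · rintro ⟨h, hp⟩
    exact ⟨⟨_, h 0⟩, ⟨_, h 1⟩, rfl, rfl, congr_arg Subtype.val hp⟩

variable [LieRing G]

theorem mem_iff {N : AddSubgroup G} :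
    IsDefinableRel L (fun x : Fin 1 → G => x 0 ∈ N) ↔ IsDefinableSubgroup L N := by
  constructor
  · intro h
    refine Set.Definable.of_eq ?_ (h.preimage_comp (fun p : Fin 1 × Fin k => p.2))
    ext p
    constructor
    · rintro ⟨h, hp⟩
      exact ⟨_, hp, rfl⟩
    · rintro ⟨x, hx, rfl⟩
      exact ⟨fun _ => x.2, hx⟩
  · intro h
    refine Set.Definable.of_eq ?_ (h.preimage_comp (fun i : Fin k => ((0 : Fin 1), i)))
    ext p
    constructor
    · rintro ⟨x, hx, hp⟩
      have hp' : (x : Fin k → M) = fun i => p (0, i) := hp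
      have hG : (fun i => p (0, i)) ∈ G := hp' ▸ x.2
      refine ⟨fun a => by rw [Subsingleton.elim a 0]; exact hG, ?_⟩
      exact (congr_arg (· ∈ N) (Subtype.ext hp')).mp hx
    · rintro ⟨h, hp⟩
      exact ⟨_, hp, rfl⟩

end IsDefinableRel

namespace IsDefinableLieRing

open IsDefinableRel

variable [LieRing G]

theorem isDefinableRel_lie_sub_mem (hG : IsDefinableLieRing L G) {N : AddSubgroup G}
    (hN : IsDefinableSubgroup L N) :
    IsDefinableRel L fun x : Fin 3 → G => ⁅x 0, x 1 - x 2⁆ ∈ N := by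
  -- Coordinate `inr 0` is the difference, encoded by `x 1 = y 0 + x 2`; `inr 1` is its bracket with
  -- `x 0`.
  have h₁ := (of_ternary hG.add).comp hG.carrier
    (![Sum.inr 0, Sum.inl 2, Sum.inl 1] : Fin 3 → Fin 3 ⊕ Fin 2)
  have h₂ := (of_ternary hG.bracket).comp hG.carrier
    (![Sum.inl 0, Sum.inr 0, Sum.inr 1] : Fin 3 → Fin 3 ⊕ Fin 2)
  have h₃ := (mem_iff.2 hN).comp hG.carrier (![Sum.inr 1] : Fin 1 → Fin 3 ⊕ Fin 2)
  refine (h₁.and (h₂.and h₃)).ex.congr fun x => ?_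
  simp only [Function.comp_apply, Matrix.cons_val, Sum.elim_inl, Sum.elim_inr]
  constructor
  · rintro ⟨y, hy₁, hy₂, hy₃⟩
    rwa [hy₁, add_sub_cancel_right, ← hy₂]
  · intro h
    exact ⟨![x 1 - x 2, ⁅x 0, x 1 - x 2⁆], by simp, by simp, by simpa using h⟩

theorem isDefinableRel_lie_mem (hG : IsDefinableLieRing L G) {N : AddSubgroup G}
    (hN : IsDefinableSubgroup L N) (s : G) :
    IsDefinableRel L fun x : Fin 1 → G => ⁅s, x 0⁆ ∈ N := by
  have h₁ := (eq_const (L := L) s).comp hG.carrier (![Sum.inr 0] : Fin 1 → Fin 1 ⊕ Fin 2)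
  have h₂ := (of_ternary hG.bracket).comp hG.carrier
    (![Sum.inr 0, Sum.inl 0, Sum.inr 1] : Fin 3 → Fin 1 ⊕ Fin 2)
  have h₃ := (mem_iff.2 hN).comp hG.carrier (![Sum.inr 1] : Fin 1 → Fin 1 ⊕ Fin 2)
  refine (h₁.and (h₂.and h₃)).ex.congr fun x => ?_
  simp only [Function.comp_apply, Matrix.cons_val, Sum.elim_inl, Sum.elim_inr]
  constructor
  · rintro ⟨y, hy₁, hy₂, hy₃⟩
    rwa [← hy₁, ← hy₂]
  · intro h
    exact ⟨![s, ⁅s, x 0⁆], by simp, by simp, by simpa using h⟩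

theorem isDefinableRel_sub_mem (hG : IsDefinableLieRing L G) {N : AddSubgroup G}
    (hN : IsDefinableSubgroup L N) (t : G) :
    IsDefinableRel L fun x : Fin 1 → G => x 0 - t ∈ N := by
  have h₁ := (eq_const (L := L) t).comp hG.carrier (![Sum.inr 0] : Fin 1 → Fin 1 ⊕ Fin 2)
  have h₂ := (of_ternary hG.add).comp hG.carrier
    (![Sum.inr 1, Sum.inr 0, Sum.inl 0] : Fin 3 → Fin 1 ⊕ Fin 2)
  have h₃ := (mem_iff.2 hN).comp hG.carrier (![Sum.inr 1] : Fin 1 → Fin 1 ⊕ Fin 2)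
  refine (h₁.and (h₂.and h₃)).ex.congr fun x => ?_
  simp only [Function.comp_apply, Matrix.cons_val, Sum.elim_inl, Sum.elim_inr]
  constructor
  · rintro ⟨y, hy₁, hy₂, hy₃⟩
    rwa [hy₂, hy₁, add_sub_cancel_right]
  · intro h
    exact ⟨![t, x 0 - t], by simp, by simp, by simpa using h⟩

theorem isDefinableSubgroup_bot : IsDefinableSubgroup L (⊥ : AddSubgroup G) :=
  mem_iff.1 ((eq_const (L := L) (0 : G)).congr fun _ => AddSubgroup.mem_bot.symm)

/-- `W` is a finite union of cosets of `N`; the existential over representatives is written as `¬ ∀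
¬`. -/
theorem isDefinableSubgroup_of_relIndex_ne_zero (hG : IsDefinableLieRing L G)
    {N W : AddSubgroup G} (hN : IsDefinableSubgroup L N) (hNW : N ≤ W)
    (h : N.relIndex W ≠ 0) : IsDefinableSubgroup L W := by
  obtain ⟨T, hTW, hT⟩ := LieRing.exists_finset_sub_mem h
  refine mem_iff.1 ((((forall_finite hG.carrier fun t : T =>
    (hG.isDefinableRel_sub_mem hN (t : G)).not hG.carrier)).not hG.carrier).congr fun x => ?_)
  push Not
  constructor
  · rintro ⟨t, ht⟩
    simpa using add_mem (hNW ht) (hTW t t.2)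
  · intro hx
    obtain ⟨t, ht, htN⟩ := hT _ hx
    exact ⟨⟨t, ht⟩, htN⟩

theorem isDefinableSubgroup_of_mem_iff (hG : IsDefinableLieRing L G) {N A : AddSubgroup G}
    {X : Set G} {d : ℕ} (hN : IsDefinableSubgroup L N) (hX : X.Finite)
    (h : ∀ x, x ∈ A ↔ ¬ IndexAtLeast (centraliserMod X N) (centraliserMod {x} N) d) :
    IsDefinableSubgroup L A := by
  have := hX.to_subtype
  have h₁ := forall_finite hG.carrier fun i : Fin d =>
    (forall_finite hG.carrier fun s : X => hG.isDefinableRel_lie_mem hN (s : G)).comp hG.carrier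
      (![Sum.inr i] : Fin 1 → Fin 1 ⊕ Fin d)
  have h₂ := forall_finite hG.carrier fun p : {p : Fin d × Fin d // p.1 ≠ p.2} =>
    ((hG.isDefinableRel_lie_sub_mem hN).comp hG.carrier
      (![Sum.inl 0, Sum.inr p.1.1, Sum.inr p.1.2] : Fin 3 → Fin 1 ⊕ Fin d)).not hG.carrier
  refine mem_iff.1 (((h₁.and h₂).ex.not hG.carrier).congr fun x => ?_)
  rw [h, LieRing.indexAtLeast_iff]
  simp only [Function.comp_apply, Matrix.cons_val, Sum.elim_inl, Sum.elim_inr,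
    LieRing.mem_centraliserMod_singleton]
  refine not_congr (exists_congr fun b => and_congr ?_ ?_)
  · exact forall_congr' fun i => ⟨fun h s hs => h ⟨s, hs⟩, fun h s => h s s.2⟩
  · exact ⟨fun h i j hij => h ⟨(i, j), hij⟩, fun h p => h _ _ p.2⟩

theorem isChainFamily (hG : IsDefinableLieRing L G) (hMc : IsHereditarilyMc L G) :
    LieRing.IsChainFamily fun N : AddSubgroup G => IsDefinableSubgroup L N where
  chain := hMc
  bot := isDefinableSubgroup_bot
  of_relIndex_ne_zero := fun _ _ hN h h' => hG.isDefinableSubgroup_of_relIndex_ne_zero hN h h'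
  bounded := fun _ _ _ _ hN hX h => hG.isDefinableSubgroup_of_mem_iff hN hX h

end IsDefinableLieRing

end DefinableRelations

/-! ### Nilpotent ideals versus nilpotent actions, and the conclusion. -/

namespace LieRing

variable {𝔤 : Type*} [LieRing 𝔤]

theorem actsNilpotently_of_isNilpotent {I : LieIdeal ℤ 𝔤} (hI : LieRing.IsNilpotent I) :
    ActsNilpotently I := by
  obtain ⟨k, hk⟩ := LieModule.IsNilpotent.nilpotent ℤ I I
  have key : ∀ k, ∀ x ∈ iterLie I I k, ∃ y ∈ LieModule.lowerCentralSeries ℤ I I k,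
      (y : 𝔤) = x := by
    intro k
    induction k with
    | zero => exact fun x hx => ⟨⟨x, hx⟩, by simp, rfl⟩
    | succ k ih =>
      have : toAddSg (iterLie I I (k + 1)) ≤
          (LieModule.lowerCentralSeries ℤ I I (k + 1)).toSubmodule.toAddSubgroup.map
            (I.toSubmodule.subtype : I →ₗ[ℤ] 𝔤).toAddMonoidHom := by
        refine toAddSg_lie_le fun x hx y hy => ?_
        obtain ⟨y, hy', rfl⟩ := ih y hy
        refine ⟨⁅(⟨x, hx⟩ : I), y⁆, ?_, rfl⟩
        change _ ∈ LieModule.lowerCentralSeries ℤ I I (k + 1)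
        rw [LieModule.lowerCentralSeries_succ]
        exact LieSubmodule.lie_mem_lie (LieSubmodule.mem_top _) hy'
      intro x hx
      obtain ⟨y, hy, h⟩ := this hx
      exact ⟨y, hy, h⟩
  -- The extra bracket brings `⊤` into `I`.
  refine ⟨k + 1, ?_⟩
  rw [iterLie_succ']
  refine (iterLie_mono le_rfl (LieSubmodule.lie_le_left _ _) k).trans fun x hx => ?_
  obtain ⟨y, hy, rfl⟩ := key k x hx
  rw [hk, LieSubmodule.mem_bot] at hy
  simp [hy]

theorem ActsNilpotently.isNilpotent {I : LieIdeal ℤ 𝔤} (hI : ActsNilpotently I) :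
    LieRing.IsNilpotent I := by
  obtain ⟨k, hk⟩ := hI
  have key : ∀ k, LieModule.lowerCentralSeries ℤ I I k ≤
      LieIdeal.comap I.incl (iterLie I ⊤ k) := by
    intro k
    induction k with
    | zero => exact fun x _ => by simp
    | succ k ih =>
      rw [LieModule.lowerCentralSeries_succ, LieSubmodule.lie_le_iff]
      intro x _ y hy
      rw [LieIdeal.mem_comap]
      exact LieSubmodule.lie_mem_lie x.2 (LieIdeal.mem_comap.1 (ih hy))
  refine (LieModule.isNilpotent_iff ℤ I I).2
    ⟨k, (LieSubmodule.eq_bot_iff _).2 fun x hx => ?_⟩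
  have := hk (LieIdeal.mem_comap.1 (key k hx))
  exact Subtype.ext (by simpa using this)

/-- The union of all nilpotently acting ideals is an ideal, since they are closed under binary sums.
-/
theorem locallyActsNilpotently_fittingIdeal : LocallyActsNilpotently (fittingIdeal 𝔤) := by
  let F : LieIdeal ℤ 𝔤 :=
    { carrier := {x | ∃ I : LieIdeal ℤ 𝔤, ActsNilpotently I ∧ x ∈ I}
      zero_mem' := ⟨⊥, actsNilpotently_bot, zero_mem _⟩
      add_mem' := by
        rintro x y ⟨I, hI, hx⟩ ⟨J, hJ, hy⟩
        exact ⟨I ⊔ J, hI.sup hJ,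
          add_mem (LieSubmodule.mem_sup_left hx) (LieSubmodule.mem_sup_right hy)⟩
      smul_mem' := by
        rintro c x ⟨I, hI, hx⟩
        exact ⟨I, hI, I.smul_mem c hx⟩
      lie_mem := by
        rintro x y ⟨I, hI, hy⟩
        exact ⟨I, hI, I.lie_mem hy⟩ }
  have : fittingIdeal 𝔤 ≤ F :=
    sSup_le fun I hI x hx => ⟨I, actsNilpotently_of_isNilpotent hI, hx⟩
  exact fun x hx => this hx

end LieRing

theorem mainTheorem9 (L : FirstOrder.Language.{u, v}) (M : Type w) [L.Structure M] (k : ℕ)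
    (G : Set (Fin k → M)) [LieRing G] (hG : IsDefinableLieRing L G)
    (hMc : IsHereditarilyMc L G) :
    LieRing.IsNilpotent (fittingIdeal G) :=
  ((hG.isChainFamily hMc).actsNilpotently
    LieRing.locallyActsNilpotently_fittingIdeal).isNilpotent
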